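/- Let $N$ be a Kähler manifold of complex dimension $2n$ with complex structure $J$, Kähler metric $g$, Levi-Civita connection $\nabla$, Kähler form $\omega(U,V)=g(JU,V)$, curvature tensor $R^N(U,V)W=-\nabla_U\nabla_VW+\nabla_V\nabla_UW+\nabla_{[U,V]}W$, Ricci tensor $Ricci^N(U,V)=\operatorname{trace}(Z\mapsto R^N(U,Z)V)$ and Ricci form $\Psi(U,V)=Ricci^N(JU,V)$. Let $M$ be a smooth manifold of real dimension $2n$ and $F:M\to N$ a smooth immersion; give $M$ the induced metric $F^*g$. We say that the normal component of $F^*R^N$ vanishes if, for all $p\in M$ and $X,Y,Z\in T_pM$, the orthogonal projection of $R^N(dF(X),dF(Y))dF(Z)$ onto the normal space $(dF(T_pM))^{\perp}\subset T_{F(p)}N$ is zero. A complex direction of $F$ is a real two-plane $P\subset T_pM$, for some $p\in M$, with $J\,dF(P)\subset dF(P)$. (i) If $F$ is totally geodesic, i.e. its second fundamental form $\nabla dF$ vanishes, then the normal component of $F^*R^N$ vanishes. (ii) If the normal component of $F^*R^N$ vanishes (in particular, if $F$ is totally geodesic) and $F$ has no complex directions, then $F^*\Psi=0$, that is, $\Psi(dF(X),dF(Y))=0$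 for all $p\in M$ and $X,Y\in T_pM$. If in addition $N$ is Kähler–Einstein, i.e. $Ricci^N=c\,g$ with a constant $c$, and $Ricci^N$ is not identically zero, then $F$ is Lagrangian, that is, $F^*\omega=0$. -/

import Mathlib

set_option maxSynthPendingDepth 3

open scoped Manifold ContDiff Topology

/-! ### Riemannian geometry in charts

`E` is a real normed space and `M` a manifold modelled on `E`, without boundary. A field of bilinear
forms on the tangent spaces of `M` (a Riemannian metric, a two-form, ...) is a function
`b : ∀ x : M, TangentSpace 𝓘(ℝ, E) x →L[ℝ] TangentSpace 𝓘(ℝ, E) x →L[ℝ] ℝ`. -/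

section Charts

variable {E : Type*} [NormedAddCommGroup E] [NormedSpace ℝ E]
  {M : Type*} [TopologicalSpace M] [ChartedSpace E M]

/-- The coordinate expression of a field `b` of bilinear forms in the chart `φ`: at `z ∈ φ.target`
it is the pullback `(φ⁻¹)^* b`, that is `(u, v) ↦ b (d(φ⁻¹)_z u, d(φ⁻¹)_z v)`. -/
noncomputable def formInChart
    (b : ∀ x : M, TangentSpace 𝓘(ℝ, E) x →L[ℝ] TangentSpace 𝓘(ℝ, E) x →L[ℝ] ℝ)
    (φ : OpenPartialHomeomorph M E) (z : E) : E →L[ℝ] E →L[ℝ] ℝ :=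
  let B : E →L[ℝ] E →L[ℝ] ℝ := b (φ.symm z)
  let L : E →L[ℝ] E := mfderiv 𝓘(ℝ, E) 𝓘(ℝ, E) φ.symm z
  (B.bilinearComp L L : E →L[ℝ] E →L[ℝ] ℝ)

/-- For a field `G` of bilinear forms on `E`, the map
`(u, v) ↦ (w ↦ ∂_u G (v, w) + ∂_v G (u, w) - ∂_w G (u, v))`
(twice the Christoffel symbols of the first kind). -/
noncomputable def christoffelLower (G : E → E →L[ℝ] E →L[ℝ] ℝ) (z : E) :
    E →L[ℝ] E →L[ℝ] E →L[ℝ] ℝ :=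
  let D : E →L[ℝ] E →L[ℝ] E →L[ℝ] ℝ := fderiv ℝ G z
  let T : E →L[ℝ] E →L[ℝ] E →L[ℝ] ℝ :=
    ((ContinuousLinearMap.flipₗᵢ ℝ E E ℝ : (E →L[ℝ] E →L[ℝ] ℝ) →L[ℝ] E →L[ℝ] E →L[ℝ] ℝ)).comp D.flip
  D + D.flip - T

theorem christoffelLower_apply (G : E → E →L[ℝ] E →L[ℝ] ℝ) (z u v w : E) :
    christoffelLower G z u v w =
      fderiv ℝ G z u v w + fderiv ℝ G z v u w - fderiv ℝ G z w u v := rfl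

/-- The Christoffel symbols of the metric `G` on (an open subset of) `E`: where `G z` is a
nondegenerate bilinear form, `christoffel G z u v` is the vector `Γ_z(u, v)` with
`2 G_z (Γ_z(u, v), w) = ∂_u G (v, w) + ∂_v G (u, w) - ∂_w G (u, v)` for all `w`, i.e. the
Levi-Civita derivative `∇_u v` of the constant vector field `v` in the direction `u`. -/
noncomputable def christoffel (G : E → E →L[ℝ] E →L[ℝ] ℝ) (z : E) : E →L[ℝ] E →L[ℝ] E :=
  (1 / 2 : ℝ) •
    (ContinuousLinearMap.compL ℝ E (E →L[ℝ] ℝ) E (ContinuousLinearMap.inverse (G z))) ∘L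
      christoffelLower G z

theorem christoffel_apply (G : E → E →L[ℝ] E →L[ℝ] ℝ) (z u v : E) :
    christoffel G z u v =
      (1 / 2 : ℝ) • ContinuousLinearMap.inverse (G z) (christoffelLower G z u v) := rfl

/-- The curvature tensor of the metric `G` on (an open subset of) `E`, with the sign convention
`R(u, v) w = - ∇_u ∇_v w + ∇_v ∇_u w + ∇_[u, v] w`, evaluated on constant vector fields (whose Lie
brackets vanish). -/
noncomputable def localCurvature (G : E → E →L[ℝ] E →L[ℝ] ℝ) (z u v w : E) : E :=
  -(fderiv ℝ (christoffel G) z u v w + christoffel G z u (christoffel G z v w))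
    + (fderiv ℝ (christoffel G) z v u w + christoffel G z v (christoffel G z u w))

/-- The linear map `z' ↦ R(u, z') v` for the metric `G` at `z`. -/
noncomputable def localCurvatureEndo (G : E → E →L[ℝ] E →L[ℝ] ℝ) (z u v : E) : E →ₗ[ℝ] E where
  toFun a := localCurvature G z u a v
  map_add' a b := by
    simp only [localCurvature, map_add, add_apply]
    abel
  map_smul' c a := by
    simp only [localCurvature, map_smul, smul_apply, RingHom.id_apply]
    module

/-- The curvature tensor `R(u, v) w = - ∇_u ∇_v w + ∇_v ∇_u w + ∇_[u, v] w` of the metric `g` at the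
point `x`, computed in the preferred chart at `x`. (The tangent space at `x` is by definition the
model space `E`, a vector being identified with its coordinates in the preferred chart at `x`.) -/
noncomputable def curvature
    (g : ∀ x : M, TangentSpace 𝓘(ℝ, E) x →L[ℝ] TangentSpace 𝓘(ℝ, E) x →L[ℝ] ℝ)
    (x : M) (u v w : TangentSpace 𝓘(ℝ, E) x) : TangentSpace 𝓘(ℝ, E) x :=
  localCurvature (E := E) (formInChart g (chartAt E x)) (chartAt E x x) u v w

/-- The linear map `z ↦ R(u, z) v` of the tangent space at `x`. -/
noncomputable def curvatureEndo
    (g : ∀ x : M, TangentSpace 𝓘(ℝ, E) x →L[ℝ] TangentSpace 𝓘(ℝ, E) x →L[ℝ] ℝ)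
    (x : M) (u v : TangentSpace 𝓘(ℝ, E) x) :
    TangentSpace 𝓘(ℝ, E) x →ₗ[ℝ] TangentSpace 𝓘(ℝ, E) x :=
  localCurvatureEndo (E := E) (formInChart g (chartAt E x)) (chartAt E x x) u v

theorem curvatureEndo_apply
    (g : ∀ x : M, TangentSpace 𝓘(ℝ, E) x →L[ℝ] TangentSpace 𝓘(ℝ, E) x →L[ℝ] ℝ)
    (x : M) (u v z : TangentSpace 𝓘(ℝ, E) x) :
    curvatureEndo g x u v z = curvature g x u z v := rfl

/-- The Ricci tensor `Ric(u, v) = trace (z ↦ R(u, z) v)`; with the sign convention used for `R`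
this is positive on round spheres. -/
noncomputable def ricci
    (g : ∀ x : M, TangentSpace 𝓘(ℝ, E) x →L[ℝ] TangentSpace 𝓘(ℝ, E) x →L[ℝ] ℝ)
    (x : M) (u v : TangentSpace 𝓘(ℝ, E) x) : ℝ :=
  LinearMap.trace ℝ (TangentSpace 𝓘(ℝ, E) x) (curvatureEndo g x u v)

/-- The field `b` of (alternating) bilinear forms is closed: in every chart of the atlas
`∂_u b (v, w) + ∂_v b (w, u) + ∂_w b (u, v) = 0`. -/
def IsClosedTwoForm
    (b : ∀ x : M, TangentSpace 𝓘(ℝ, E) x →L[ℝ] TangentSpace 𝓘(ℝ, E) x →L[ℝ] ℝ) : Prop :=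
  ∀ φ ∈ atlas E M, ∀ z ∈ φ.target, ∀ u v w : E,
    fderiv ℝ (formInChart b φ) z u v w + fderiv ℝ (formInChart b φ) z v w u
      + fderiv ℝ (formInChart b φ) z w u v = 0

/-- The Einstein condition `Ric = c g` with a constant `c`. -/
def IsEinstein
    (g : ∀ x : M, TangentSpace 𝓘(ℝ, E) x →L[ℝ] TangentSpace 𝓘(ℝ, E) x →L[ℝ] ℝ) : Prop :=
  ∃ c : ℝ, ∀ (x : M) (u v : TangentSpace 𝓘(ℝ, E) x), ricci g x u v = c * g x u v

end Charts

/-! ### Maps into a Riemannian manifold -/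

section Maps

variable {E : Type*} [NormedAddCommGroup E] [NormedSpace ℝ E]
  {M : Type*} [TopologicalSpace M] [ChartedSpace E M]
  {V : Type*} [NormedAddCommGroup V] [NormedSpace ℝ V]
  {N : Type*} [TopologicalSpace N] [ChartedSpace V N]

/-- The pullback `F^* b` of a field of bilinear forms; for a metric `b = g` and an immersion `F`
this is the induced metric `g_M = F^* g`. -/
noncomputable def pullbackForm
    (b : ∀ y : N, TangentSpace 𝓘(ℝ, V) y →L[ℝ] TangentSpace 𝓘(ℝ, V) y →L[ℝ] ℝ) (F : M → N)
    (x : M) : TangentSpace 𝓘(ℝ, E) x →L[ℝ] TangentSpace 𝓘(ℝ, E) x →L[ℝ] ℝ :=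
  let B : V →L[ℝ] V →L[ℝ] ℝ := b (F x)
  let L : E →L[ℝ] V := mfderiv 𝓘(ℝ, E) 𝓘(ℝ, V) F x
  (B.bilinearComp L L : E →L[ℝ] E →L[ℝ] ℝ)

/-- The second fundamental form `∇dF (u, v)` of `F : (M, F^* g) → (N, g)` in the charts `φ` of `M`
and `ψ` of `N`: with `f = ψ ∘ F ∘ φ⁻¹` it is
`D²f (u, v) + Γ^N (Df u, Df v) - Df (Γ^M (u, v))`, where `Γ^M` and `Γ^N` are the Christoffel symbols
of the induced metric and of `g`. -/
noncomputable def secondFundamentalForm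
    (g : ∀ y : N, TangentSpace 𝓘(ℝ, V) y →L[ℝ] TangentSpace 𝓘(ℝ, V) y →L[ℝ] ℝ) (F : M → N)
    (φ : OpenPartialHomeomorph M E) (ψ : OpenPartialHomeomorph N V) (z u v : E) : V :=
  fderiv ℝ (fderiv ℝ (ψ ∘ F ∘ φ.symm)) z u v
    + christoffel (formInChart g ψ) (ψ (F (φ.symm z)))
        (fderiv ℝ (ψ ∘ F ∘ φ.symm) z u) (fderiv ℝ (ψ ∘ F ∘ φ.symm) z v)
    - fderiv ℝ (ψ ∘ F ∘ φ.symm) z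
        (christoffel (formInChart (pullbackForm (E := E) g F) φ) z u v)

/-- `F` is totally geodesic: `∇dF = 0`, in all charts of the atlases. -/
def IsTotallyGeodesic
    (g : ∀ y : N, TangentSpace 𝓘(ℝ, V) y →L[ℝ] TangentSpace 𝓘(ℝ, V) y →L[ℝ] ℝ)
    (F : M → N) : Prop :=
  ∀ φ ∈ atlas E M, ∀ ψ ∈ atlas V N, ∀ z ∈ φ.target, F (φ.symm z) ∈ ψ.source →
    ∀ u v : E, secondFundamentalForm g F φ ψ z u v = 0

/-- `ν ∈ T_{F(p)} N` is normal to `F` at `p`: it is `g`-orthogonal to `dF (T_p M)`. -/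
def IsNormalVector (E : Type*) [NormedAddCommGroup E] [NormedSpace ℝ E] [ChartedSpace E M]
    (g : ∀ y : N, TangentSpace 𝓘(ℝ, V) y →L[ℝ] TangentSpace 𝓘(ℝ, V) y →L[ℝ] ℝ)
    (F : M → N) (p : M) (ν : TangentSpace 𝓘(ℝ, V) (F p)) : Prop :=
  ∀ X : TangentSpace 𝓘(ℝ, E) p, g (F p) (mfderiv 𝓘(ℝ, E) 𝓘(ℝ, V) F p X) ν = 0

/-- The normal component of `F^* R^N (X, Y) Z = R^N (dF X, dF Y) dF Z` vanishes for all tangent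
vectors `X, Y, Z` of `M`: the orthogonal projection of this vector to the normal space is zero,
i.e. its inner product with every normal vector is zero. -/
def NormalCurvatureVanishes (E : Type*) [NormedAddCommGroup E] [NormedSpace ℝ E]
    [ChartedSpace E M]
    (g : ∀ y : N, TangentSpace 𝓘(ℝ, V) y →L[ℝ] TangentSpace 𝓘(ℝ, V) y →L[ℝ] ℝ)
    (F : M → N) : Prop :=
  ∀ (p : M) (X Y Z : TangentSpace 𝓘(ℝ, E) p) (ν : TangentSpace 𝓘(ℝ, V) (F p)),
    IsNormalVector E g F p ν →
      g (F p) (curvature g (F p) (mfderiv 𝓘(ℝ, E) 𝓘(ℝ, V) F p X)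
        (mfderiv 𝓘(ℝ, E) 𝓘(ℝ, V) F p Y) (mfderiv 𝓘(ℝ, E) 𝓘(ℝ, V) F p Z)) ν = 0

end Maps

/-! ### Kähler manifolds -/

section Kaehler

variable {V : Type*} [NormedAddCommGroup V] [NormedSpace ℂ V]
  {N : Type*} [TopologicalSpace N] [ChartedSpace V N]

/-- A complex manifold is a smooth real manifold. -/
instance complexManifold_toReal [IsManifold 𝓘(ℂ, V) ω N] : IsManifold 𝓘(ℝ, V) ∞ N := by
  refine isManifold_of_contDiffOn 𝓘(ℝ, V) ∞ N fun e e' he he' => ?_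
  have h := (contDiffGroupoid ω 𝓘(ℂ, V)).compatible he he'
  rw [contDiffGroupoid, mem_groupoid_of_pregroupoid] at h
  have h2 : ContDiffOn ℂ ω (𝓘(ℂ, V) ∘ (e.symm ≫ₕ e') ∘ 𝓘(ℂ, V).symm)
      (𝓘(ℂ, V).symm ⁻¹' (e.symm ≫ₕ e').source ∩ Set.range 𝓘(ℂ, V)) := h.1
  simpa using ((by simpa using h2 : ContDiffOn ℂ ω (e.symm ≫ₕ e')
    (e.symm ≫ₕ e').source).restrict_scalars ℝ).of_le (m := ∞) le_top

/-- The complex structure `J` of the complex manifold `N` on the tangent space at `y`: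
multiplication by the imaginary unit in the preferred holomorphic chart at `y` (hence in every
holomorphic chart around `y`). -/
noncomputable def complexStructure (y : N) :
    TangentSpace 𝓘(ℝ, V) y →L[ℝ] TangentSpace 𝓘(ℝ, V) y :=
  (Complex.I • ContinuousLinearMap.id ℝ V : V →L[ℝ] V)

/-- The Kähler form `ω(u, v) = g(J u, v)`. -/
noncomputable def kaehlerForm
    (g : ∀ y : N, TangentSpace 𝓘(ℝ, V) y →L[ℝ] TangentSpace 𝓘(ℝ, V) y →L[ℝ] ℝ) (y : N) :
    TangentSpace 𝓘(ℝ, V) y →L[ℝ] TangentSpace 𝓘(ℝ, V) y →L[ℝ] ℝ :=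
  (g y) ∘L complexStructure y

/-- The metric `g` on the complex manifold `N` is a Kähler metric: it is Hermitian and its Kähler
form is closed. -/
structure IsKaehler
    (g : ∀ y : N, TangentSpace 𝓘(ℝ, V) y →L[ℝ] TangentSpace 𝓘(ℝ, V) y →L[ℝ] ℝ) : Prop where
  hermitian : ∀ (y : N) (u v : TangentSpace 𝓘(ℝ, V) y),
    g y (complexStructure y u) (complexStructure y v) = g y u v
  closed : IsClosedTwoForm (kaehlerForm g)

/-- The Ricci form `Ψ(u, v) = Ric(J u, v)`. -/
noncomputable def ricciForm
    (g : ∀ y : N, TangentSpace 𝓘(ℝ, V) y →L[ℝ] TangentSpace 𝓘(ℝ, V) y →L[ℝ] ℝ) (y : N)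
    (u v : TangentSpace 𝓘(ℝ, V) y) : ℝ :=
  ricci g y (complexStructure y u) v

variable {M : Type*} [TopologicalSpace M]

/-- `F` has no complex directions: no real two-plane `P` in a tangent space `T_p M` is such that
`dF (P)` is a complex line, i.e. `J dF (P) ⊆ dF (P)`. -/
def HasNoComplexDirections (E : Type*) [NormedAddCommGroup E] [NormedSpace ℝ E]
    [ChartedSpace E M] (F : M → N) : Prop :=
  ∀ (p : M) (P : Submodule ℝ (TangentSpace 𝓘(ℝ, E) p)), Module.finrank ℝ P = 2 →
    ¬ (∀ X ∈ P, ∃ Y ∈ P, complexStructure (F p) (mfderiv 𝓘(ℝ, E) 𝓘(ℝ, V) F p X) =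
        mfderiv 𝓘(ℝ, E) 𝓘(ℝ, V) F p Y)

/-- An immersion `F` of half the real dimension is Lagrangian when `F^* ω = 0`. -/
def IsLagrangian (E : Type*) [NormedAddCommGroup E] [NormedSpace ℝ E] [ChartedSpace E M]
    (g : ∀ y : N, TangentSpace 𝓘(ℝ, V) y →L[ℝ] TangentSpace 𝓘(ℝ, V) y →L[ℝ] ℝ)
    (F : M → N) : Prop :=
  ∀ (p : M) (X Y : TangentSpace 𝓘(ℝ, E) p), kaehlerForm g (F p)
    (mfderiv 𝓘(ℝ, E) 𝓘(ℝ, V) F p X) (mfderiv 𝓘(ℝ, E) 𝓘(ℝ, V) F p Y) = 0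

end Kaehler

/-! ### Metrics on open subsets of a finite-dimensional space -/

section LocalMetric

variable {E : Type*} [NormedAddCommGroup E] [NormedSpace ℝ E]

/-! For a totally geodesic `F`, the Gauss formula in charts reads `D²f(v, w) + Γ(Df v, Df w) =
Df(C(v, w))`. Differentiating once more and antisymmetrizing kills the third derivatives of `f` and
leaves `R(Df u, Df v) Df w` in the range of `Df` (`localCurvature_mem_range`). For the Ricci form,
fix `p` and put `T = dF(T_pM)`, `A = R(dF X, dF Y)`. The Kähler condition makes `A` commute with `J`
(`localCurvature_complex`), and vanishing of the normal component means that `A` preserves `T`.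
Without complex directions `T ∩ JT = 0`, so by dimension `T_{F(p)}N = T ⊕ JT`. Then `A ∘ J`
exchanges `T` and `JT`, hence has trace zero (`trace_comp_complex_eq_zero`). The Bianchi identity
gives `tr(R(u, v) ∘ J) = -2 Ric(Ju, v)` (`trace_localCurvatureOperator_comp`), so `F^*Ψ = 0`. In the
Einstein case `Ψ = cω` with `c ≠ 0`. All tensor identities are proved for metrics on open subsets of
the model space and transferred through charts. -/

theorem differentiableAt_inverse_comp {X F : Type*} [NormedAddCommGroup X] [NormedSpace ℝ X]
    [CompleteSpace E]
    [NormedAddCommGroup F] [NormedSpace ℝ F]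
    {A : X → E →L[ℝ] F} {x : X} (hA : DifferentiableAt ℝ A x) (e : E ≃L[ℝ] F)
    (he : (e : E →L[ℝ] F) = A x) :
    DifferentiableAt ℝ (fun y => ContinuousLinearMap.inverse (A y)) x := by
  have h : ContDiffAt ℝ 1 (ContinuousLinearMap.inverse : (E →L[ℝ] F) → _) (A x) := by
    rw [← he]; exact contDiffAt_map_inverse e
  exact (h.differentiableAt one_ne_zero).comp x hA

/-- `G` is a metric of class `C²` near `z`. -/
structure IsMetricNear (G : E → E →L[ℝ] E →L[ℝ] ℝ) (z : E) : Prop where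
  contDiffAt : ContDiffAt ℝ 2 G z
  symm : ∀ᶠ y in 𝓝 z, ∀ u v, G y u v = G y v u
  pos : ∀ᶠ y in 𝓝 z, ∀ v, v ≠ 0 → 0 < G y v v

variable {G : E → E →L[ℝ] E →L[ℝ] ℝ} {z : E}

/-- Pointwise identities for metrics thereby hold on a neighbourhood and can be differentiated. -/
theorem IsMetricNear.eventually (h : IsMetricNear G z) : ∀ᶠ y in 𝓝 z, IsMetricNear G y := by
  filter_upwards [h.contDiffAt.eventually (by simp), h.symm.eventually_nhds,
    h.pos.eventually_nhds] with y h1 h2 h3 using ⟨h1, h2, h3⟩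

theorem IsMetricNear.differentiableAt (h : IsMetricNear G z) : DifferentiableAt ℝ G z :=
  h.contDiffAt.differentiableAt two_ne_zero

theorem IsMetricNear.differentiableAt_fderiv (h : IsMetricNear G z) :
    DifferentiableAt ℝ (fderiv ℝ G) z :=
  (h.contDiffAt.fderiv_right (m := 1) (by norm_num)).differentiableAt one_ne_zero

/-- The derivative of a symmetric field of bilinear forms is symmetric. -/
theorem IsMetricNear.fderiv_symm (h : IsMetricNear G z) (t u v : E) :
    fderiv ℝ G z t u v = fderiv ℝ G z t v u := by
  have h1 : ∀ a b, HasFDerivAt (fun y => G y a b)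
      (((ContinuousLinearMap.apply ℝ ℝ b).comp (ContinuousLinearMap.apply ℝ _ a)).comp
        (fderiv ℝ G z)) z := fun a b =>
    ((ContinuousLinearMap.apply ℝ ℝ b).comp
      (ContinuousLinearMap.apply ℝ (E →L[ℝ] ℝ) a)).hasFDerivAt.comp z h.differentiableAt.hasFDerivAt
  have h2 := (h1 v u).congr_of_eventuallyEq (f₁ := fun y => G y u v)
    (h.symm.mono fun y hy => hy u v)
  have := congrArg (fun L => L t) ((h1 u v).unique h2)
  simpa using this

theorem localCurvature_antisymm (u v w : E) :
    localCurvature G z u v w = -localCurvature G z v u w := by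
  simp only [localCurvature]; abel

theorem IsMetricNear.christoffel_symm (h : IsMetricNear G z) (u v : E) :
    christoffel G z u v = christoffel G z v u := by
  rw [christoffel_apply, christoffel_apply]
  congr 2
  ext w
  rw [christoffelLower_apply, christoffelLower_apply, h.fderiv_symm w u v]
  ring

variable [FiniteDimensional ℝ E]

/-- A positive definite bilinear form on a finite-dimensional space identifies the space with its
dual. -/
theorem exists_equiv_of_pos (B : E →L[ℝ] E →L[ℝ] ℝ) (hB : ∀ v, v ≠ 0 → 0 < B v v) :
    ∃ e : E ≃L[ℝ] (E →L[ℝ] ℝ), (e : E →L[ℝ] E →L[ℝ] ℝ) = B := by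
  have hinj : Function.Injective (B : E →ₗ[ℝ] E →L[ℝ] ℝ) := by
    rw [← LinearMap.ker_eq_bot, LinearMap.ker_eq_bot']
    intro v hv
    by_contra h
    have hv' : B v = 0 := hv
    have := hB v h
    simp [hv'] at this
  have hdim : Module.finrank ℝ E = Module.finrank ℝ (E →L[ℝ] ℝ) := by
    rw [← (LinearMap.toContinuousLinearMap (𝕜 := ℝ) (E := E) (F' := ℝ)).finrank_eq]
    exact (Subspace.dual_finrank_eq (K := ℝ) (V := E)).symm
  refine ⟨(LinearMap.linearEquivOfInjective _ hinj hdim).toContinuousLinearEquiv, ?_⟩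
  ext v w
  rfl

/-- The Koszul formula. Positivity matters because `ContinuousLinearMap.inverse` takes the default
value zero at non-invertible maps. -/
theorem IsMetricNear.inner_christoffel (h : IsMetricNear G z) (u v w : E) :
    2 * G z (christoffel G z u v) w = christoffelLower G z u v w := by
  obtain ⟨e, he⟩ := exists_equiv_of_pos (G z) h.pos.self_of_nhds
  rw [christoffel_apply, ← he, ContinuousLinearMap.inverse_equiv]
  simp

/-- Metric compatibility `∇G = 0`: in the sum of two Koszul formulas all other derivatives of `G`
cancel. -/
theorem IsMetricNear.fderiv_eq (h : IsMetricNear G z) (t u v : E) :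
    fderiv ℝ G z t u v = G z (christoffel G z t u) v + G z u (christoffel G z t v) := by
  have h1 := h.inner_christoffel t u v
  have h2 := h.inner_christoffel t v u
  rw [christoffelLower_apply] at h1 h2
  rw [h.symm.self_of_nhds u]
  have := h.fderiv_symm t u v
  have := h.fderiv_symm u t v
  have := h.fderiv_symm v t u
  linarith

theorem IsMetricNear.differentiableAt_christoffel (h : IsMetricNear G z) :
    DifferentiableAt ℝ (christoffel G) z := by
  obtain ⟨e, he⟩ := exists_equiv_of_pos (G z) h.pos.self_of_nhds
  have h1 := differentiableAt_inverse_comp h.differentiableAt e he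
  have h2 : DifferentiableAt ℝ (christoffelLower G) z := by
    have hD := h.differentiableAt_fderiv
    have hF : DifferentiableAt ℝ (fun y => (fderiv ℝ G y).flip) z :=
      (ContinuousLinearMap.flipₗᵢ ℝ E E (E →L[ℝ] ℝ)).toContinuousLinearEquiv.differentiableAt.comp z hD
    unfold christoffelLower
    exact (hD.add hF).sub ((differentiableAt_const _).clm_comp hF)
  have h3 : DifferentiableAt ℝ
      (fun y => ContinuousLinearMap.compL ℝ E (E →L[ℝ] ℝ) E (ContinuousLinearMap.inverse (G y))) z :=
    (ContinuousLinearMap.compL ℝ E (E →L[ℝ] ℝ) E).differentiableAt.comp z h1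
  unfold christoffel
  exact (h3.clm_comp h2).const_smul (1 / 2 : ℝ)

theorem IsMetricNear.fderiv_christoffel_symm (h : IsMetricNear G z) (t u v : E) :
    fderiv ℝ (christoffel G) z t u v = fderiv ℝ (christoffel G) z t v u := by
  have h1 : (fun y => christoffel G y) =ᶠ[𝓝 z] fun y => (christoffel G y).flip := by
    filter_upwards [h.eventually] with y hy
    ext a b
    exact hy.christoffel_symm a b
  have h2 : HasFDerivAt (fun y => (christoffel G y).flip) _ z :=
    (ContinuousLinearMap.flipₗᵢ ℝ E E E).toContinuousLinearEquiv.hasFDerivAt.comp z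
      h.differentiableAt_christoffel.hasFDerivAt
  have h3 := h.differentiableAt_christoffel.hasFDerivAt.unique (h2.congr_of_eventuallyEq h1)
  have := congrArg (fun L => L t u v) h3
  simpa using this

/-- Torsion-freeness: since `Γ` and its derivative are symmetric in the two vector arguments, the
cyclic sum cancels term by term. -/
theorem IsMetricNear.localCurvature_bianchi (h : IsMetricNear G z) (u v w : E) :
    localCurvature G z u v w + localCurvature G z v w u + localCurvature G z w u v = 0 := by
  simp only [localCurvature]
  rw [h.fderiv_christoffel_symm u v w, h.fderiv_christoffel_symm v u w,
    h.fderiv_christoffel_symm w u v, h.christoffel_symm v w, h.christoffel_symm u w,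
    h.christoffel_symm u v]
  abel

/-- Differentiate metric compatibility again: the second derivative of `G` is symmetric in `t`, `u`,
and the antisymmetric part of the right-hand side is exactly the curvature expression. -/
theorem IsMetricNear.localCurvature_skew (h : IsMetricNear G z) (t u v w : E) :
    G z (localCurvature G z t u v) w + G z v (localCurvature G z t u w) = 0 := by
  have hΓ : ∀ a b : E, HasFDerivAt (fun y => christoffel G y a b)
      (((ContinuousLinearMap.apply ℝ E b).comp (ContinuousLinearMap.apply ℝ _ a)).comp
        (fderiv ℝ (christoffel G) z)) z := fun a b =>
    ((ContinuousLinearMap.apply ℝ E b).comp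
      (ContinuousLinearMap.apply ℝ (E →L[ℝ] E) a)).hasFDerivAt.comp z
        h.differentiableAt_christoffel.hasFDerivAt
  have hG := h.differentiableAt.hasFDerivAt
  have key : ∀ t u : E, fderiv ℝ (fderiv ℝ G) z t u v w =
      fderiv ℝ G z t (christoffel G z u v) w + G z (fderiv ℝ (christoffel G) z t u v) w
      + (fderiv ℝ G z t v (christoffel G z u w) + G z v (fderiv ℝ (christoffel G) z t u w)) := by
    intro t u
    have e1 : HasFDerivAt (fun y => fderiv ℝ G y u v w)
        (((ContinuousLinearMap.apply ℝ ℝ w).comp ((ContinuousLinearMap.apply ℝ (E →L[ℝ] ℝ) v).comp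
          (ContinuousLinearMap.apply ℝ (E →L[ℝ] E →L[ℝ] ℝ) u))).comp
        (fderiv ℝ (fderiv ℝ G) z)) z :=
      ((ContinuousLinearMap.apply ℝ ℝ w).comp ((ContinuousLinearMap.apply ℝ (E →L[ℝ] ℝ) v).comp
          (ContinuousLinearMap.apply ℝ (E →L[ℝ] E →L[ℝ] ℝ) u))).hasFDerivAt.comp z
        h.differentiableAt_fderiv.hasFDerivAt
    have e2 := ((hG.clm_apply (hΓ u v)).clm_apply (hasFDerivAt_const w z)).add
      ((hG.clm_apply (hasFDerivAt_const v z)).clm_apply (hΓ u w))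
    have e3 := e1.unique (e2.congr_of_eventuallyEq
      (h.eventually.mono fun y hy => hy.fderiv_eq u v w))
    have := congrArg (fun L => L t) e3
    simp at this
    rw [this]; ring
  have hsymm : fderiv ℝ (fderiv ℝ G) z t u = fderiv ℝ (fderiv ℝ G) z u t :=
    (h.contDiffAt.isSymmSndFDerivAt (by simp)).eq t u
  have k1 := key t u
  have k2 := key u t
  rw [hsymm, k2] at k1
  simp only [h.fderiv_eq] at k1
  simp only [localCurvature, map_add, map_neg, add_apply, neg_apply]
  linarith

/-- The pair symmetry of the curvature tensor. -/
theorem IsMetricNear.localCurvature_pair_symm (h : IsMetricNear G z) (a b c d : E) :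
    G z (localCurvature G z a b c) d = G z (localCurvature G z c d a) b := by
  have B : ∀ u v w x, G z (localCurvature G z u v w) x + G z (localCurvature G z v w u) x
      + G z (localCurvature G z w u v) x = 0 := by
    intro u v w x
    have := congrArg (fun y => G z y x) (h.localCurvature_bianchi u v w)
    simpa using this
  have S : ∀ t u v w, G z (localCurvature G z t u v) w = - G z (localCurvature G z t u w) v := by
    intro t u v w
    have := h.localCurvature_skew t u v w
    rw [h.symm.self_of_nhds v] at this
    linarith
  have A : ∀ t u v w, G z (localCurvature G z t u v) w = - G z (localCurvature G z u t v) w := by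
    intro t u v w
    rw [localCurvature_antisymm]; simp
  -- The classical argument: a linear combination of four Bianchi identities, whose terms are
  -- matched by the two skew-symmetries `S` and `A`.
  linarith [B a b c d, B b c d a, B c d a b, B d a b c, S a b c d, S b c a d, S c a b d,
    S b c d a, S c d b a, S d b c a, S c d a b, S d a c b, S a c d b, S d a b c, S a b d c,
    S b d a c, A a b c d, A b c a d, A c a b d, A d b c a, A a c d b, A c d a b, A b d a c, A d a b c,
    A b d c a, A a c b d]

end LocalMetric

/-! ### The Gauss equation for vanishing second fundamental form -/

section TotallyGeodesic

variable {E V : Type*} [NormedAddCommGroup E] [NormedSpace ℝ E] [FiniteDimensional ℝ E]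
  [NormedAddCommGroup V] [NormedSpace ℝ V]

/-- With `L` a left inverse of `Df` at `z`, the map `L ∘ Df_y` is invertible for `y` near `z` and `c
y = (L ∘ Df_y)⁻¹ (L (s y))`. This spares any separate regularity argument for the Christoffel
symbols of the induced metric. -/
theorem differentiableAt_of_fderiv_apply {f : E → V} {z : E} [FiniteDimensional ℝ V]
    (hf : ContDiffAt ℝ 2 f z) (hinj : Function.Injective (fderiv ℝ f z)) {c : E → E} {s : E → V}
    (hs : DifferentiableAt ℝ s z) (hc : ∀ᶠ y in 𝓝 z, s y = fderiv ℝ f y (c y)) :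
    DifferentiableAt ℝ c z := by
  obtain ⟨L₀, hL₀⟩ := LinearMap.exists_leftInverse_of_injective (fderiv ℝ f z : E →ₗ[ℝ] V)
    (LinearMap.ker_eq_bot.2 hinj)
  set L : V →L[ℝ] E := LinearMap.toContinuousLinearMap L₀
  have hL : L ∘L fderiv ℝ f z = (ContinuousLinearEquiv.refl ℝ E : E →L[ℝ] E) := by
    ext v; exact LinearMap.congr_fun hL₀ v
  have hT : DifferentiableAt ℝ (fun y => L ∘L fderiv ℝ f y) z :=
    (differentiableAt_const L).clm_comp
      ((hf.fderiv_right (m := 1) (by norm_num)).differentiableAt one_ne_zero)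
  have hinv := differentiableAt_inverse_comp hT (ContinuousLinearEquiv.refl ℝ E) hL.symm
  have hopen : ∀ᶠ y in 𝓝 z, L ∘L fderiv ℝ f y ∈
      Set.range ((↑) : (E ≃L[ℝ] E) → E →L[ℝ] E) :=
    hT.continuousAt.eventually_mem
      (ContinuousLinearEquiv.isOpen.mem_nhds ⟨ContinuousLinearEquiv.refl ℝ E, hL.symm⟩)
  refine (hinv.clm_apply (L.differentiableAt.comp z hs)).congr_of_eventuallyEq ?_
  filter_upwards [hopen, hc] with y ⟨e, he⟩ hy
  have hey : e (c y) = L (fderiv ℝ f y (c y)) := congrArg (fun T => T (c y)) he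
  rw [Function.comp_apply, hy, ← hey, ← he, ContinuousLinearMap.inverse_equiv]
  simp

/-- If `f` is an immersion with `D²f (v, w) + Γ (Df v, Df w) = Df (C (v, w))` near `z`, where `Γ` are
the Christoffel symbols of `G`, then the curvature tensor of `G` maps triples of tangent vectors of
`f` to tangent vectors of `f`. -/
theorem localCurvature_mem_range {f : E → V} {z : E} [FiniteDimensional ℝ V]
    {G : V → V →L[ℝ] V →L[ℝ] ℝ} (hG : IsMetricNear G (f z)) (hf : ContDiffAt ℝ 3 f z)
    (hinj : Function.Injective (fderiv ℝ f z)) (C : E → E → E → E)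
    (hC : ∀ᶠ y in 𝓝 z, ∀ v w, fderiv ℝ (fderiv ℝ f) y v w
      + christoffel G (f y) (fderiv ℝ f y v) (fderiv ℝ f y w) = fderiv ℝ f y (C y v w))
    (u v w : E) :
    ∃ x, localCurvature G (f z) (fderiv ℝ f z u) (fderiv ℝ f z v) (fderiv ℝ f z w)
      = fderiv ℝ f z x := by
  have hf1 : ContDiffAt ℝ 2 (fderiv ℝ f) z := hf.fderiv_right (by norm_num)
  have hf2 : ContDiffAt ℝ 1 (fderiv ℝ (fderiv ℝ f)) z := hf1.fderiv_right (by norm_num)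
  have d0 := (hf.differentiableAt (by simp)).hasFDerivAt
  have d1 := (hf1.differentiableAt (by simp)).hasFDerivAt
  have d2 := (hf2.differentiableAt (by simp)).hasFDerivAt
  have dΓ := hG.differentiableAt_christoffel.hasFDerivAt.comp z d0
  have dS : ∀ v w : E, HasFDerivAt (fun y => fderiv ℝ (fderiv ℝ f) y v w
      + christoffel G (f y) (fderiv ℝ f y v) (fderiv ℝ f y w)) _ z := fun v w =>
    ((d2.clm_apply (hasFDerivAt_const v z)).clm_apply (hasFDerivAt_const w z)).add
      ((dΓ.clm_apply (d1.clm_apply (hasFDerivAt_const v z))).clm_apply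
        (d1.clm_apply (hasFDerivAt_const w z)))
  have dC : ∀ v w : E, DifferentiableAt ℝ (fun y => C y v w) z := fun v w =>
    differentiableAt_of_fderiv_apply (hf.of_le (by norm_num)) hinj (dS v w).differentiableAt
      (hC.mono fun y hy => hy v w)
  -- The derivative of `hC` in the direction `u`.
  have key : ∀ u v w : E, fderiv ℝ (fderiv ℝ (fderiv ℝ f)) z u v w
      + (fderiv ℝ (christoffel G) (f z) (fderiv ℝ f z u) (fderiv ℝ f z v) (fderiv ℝ f z w)
        + christoffel G (f z) (fderiv ℝ (fderiv ℝ f) z u v) (fderiv ℝ f z w)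
        + christoffel G (f z) (fderiv ℝ f z v) (fderiv ℝ (fderiv ℝ f) z u w))
      = fderiv ℝ (fderiv ℝ f) z u (C z v w)
        + fderiv ℝ f z (fderiv ℝ (fun y => C y v w) z u) := by
    intro u v w
    have e1 := (dS v w).unique ((d1.clm_apply (dC v w).hasFDerivAt).congr_of_eventuallyEq
      (hC.mono fun y hy => hy v w))
    have := congrArg (fun L => L u) e1
    simp at this
    rw [add_comm (fderiv ℝ (fderiv ℝ f) z u (C z v w)), ← this]
    abel
  have s3 : fderiv ℝ (fderiv ℝ (fderiv ℝ f)) z u v = fderiv ℝ (fderiv ℝ (fderiv ℝ f)) z v u :=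
    (hf1.isSymmSndFDerivAt (by simp)).eq u v
  have s2 : fderiv ℝ (fderiv ℝ f) z u v = fderiv ℝ (fderiv ℝ f) z v u :=
    ((hf.of_le (m := 2) (by norm_num)).isSymmSndFDerivAt (by simp)).eq u v
  have k1 := key u v w
  have k2 := key v u w
  have hz := hC.self_of_nhds
  -- Substituting for the second derivatives produces the quadratic `Γ` terms of the curvature;
  -- everything else is tangent.
  have r : ∀ a b, fderiv ℝ (fderiv ℝ f) z a b = fderiv ℝ f z (C z a b) -
      christoffel G (f z) (fderiv ℝ f z a) (fderiv ℝ f z b) := fun a b =>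
    eq_sub_of_add_eq (hz a b)
  rw [s3, s2] at k1
  rw [r u w, r u (C z v w), map_sub] at k1
  rw [r v w, r v (C z u w), map_sub] at k2
  -- The tangential terms of `key`, antisymmetrized in `u`, `v` with the sign convention of
  -- `localCurvature`.
  refine ⟨-(C z u (C z v w) + fderiv ℝ (fun y => C y v w) z u)
    + (C z v (C z u w) + fderiv ℝ (fun y => C y u w) z v), ?_⟩
  simp only [localCurvature, map_add, map_neg]
  have k3 := congrArg₂ (· - ·) k2 k1
  rw [← sub_eq_zero] at k3 ⊢
  rw [← k3]
  abel

end TotallyGeodesic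

/-! ### Kähler metrics in a holomorphic chart -/

section LocalKaehler

variable {V : Type*} [NormedAddCommGroup V] [NormedSpace ℂ V]
  {G : V → V →L[ℝ] V →L[ℝ] ℝ} {z : V}

local notation "J" => (Complex.I • ContinuousLinearMap.id ℝ V : V →L[ℝ] V)

/-- The metric `G` is Kähler near `z`. -/
structure IsKaehlerNear (G : V → V →L[ℝ] V →L[ℝ] ℝ) (z : V) : Prop extends IsMetricNear G z where
  hermitian : ∀ᶠ y in 𝓝 z, ∀ u v, G y (J u) (J v) = G y u v
  closed : ∀ᶠ y in 𝓝 z, ∀ u v w,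
    fderiv ℝ G y u (J v) w + fderiv ℝ G y v (J w) u + fderiv ℝ G y w (J u) v = 0

theorem IsKaehlerNear.eventually (h : IsKaehlerNear G z) : ∀ᶠ y in 𝓝 z, IsKaehlerNear G y := by
  filter_upwards [h.toIsMetricNear.eventually, h.hermitian.eventually_nhds,
    h.closed.eventually_nhds] with y h1 h2 h3 using ⟨h1, h2, h3⟩

theorem IsKaehlerNear.hermitian_left (h : IsKaehlerNear G z) (u v : V) :
    G z (J u) v = - G z u (J v) := by
  rw [← h.hermitian.self_of_nhds u (J v)]
  simp [smul_smul]

theorem IsKaehlerNear.fderiv_hermitian (h : IsKaehlerNear G z) (t u v : V) :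
    fderiv ℝ G z t (J u) v = - fderiv ℝ G z t u (J v) := by
  have h1 : ∀ a b, HasFDerivAt (fun y => G y a b)
      (((ContinuousLinearMap.apply ℝ ℝ b).comp (ContinuousLinearMap.apply ℝ _ a)).comp
        (fderiv ℝ G z)) z := fun a b =>
    ((ContinuousLinearMap.apply ℝ ℝ b).comp
      (ContinuousLinearMap.apply ℝ (V →L[ℝ] ℝ) a)).hasFDerivAt.comp z h.differentiableAt.hasFDerivAt
  have h2 := (h1 (J u) v).unique ((h1 u (J v)).neg.congr_of_eventuallyEq
    (h.eventually.mono fun y hy => hy.hermitian_left u v))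
  have := congrArg (fun L => L t) h2
  simpa using this

variable [FiniteDimensional ℝ V]

/-- This is `∇J = 0`, as `J` is constant in a holomorphic chart. After pairing with `w` and
expanding by Koszul, closedness of the Kähler form at `(u, v, w)` and at `(u, Jv, Jw)` cancels all
terms. -/
theorem IsKaehlerNear.christoffel_complex (h : IsKaehlerNear G z) (u v : V) :
    christoffel G z u (J v) = J (christoffel G z u v) := by
  obtain ⟨e, he⟩ := exists_equiv_of_pos (G z) h.pos.self_of_nhds
  apply e.injective
  have he' : ∀ x, e x = G z x := fun x => by rw [← he]; rfl
  rw [he', he']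
  ext w
  have JJ : ∀ x : V, J (J x) = -x := fun x => by simp [smul_smul]
  rw [h.hermitian_left]
  have h1 := h.inner_christoffel u (J v) w
  have h2 := h.inner_christoffel u v (J w)
  rw [christoffelLower_apply] at h1 h2
  have c1 := h.closed.self_of_nhds u v w
  have c2 := h.closed.self_of_nhds u (J v) (J w)
  rw [JJ, JJ] at c2
  simp only [map_neg, neg_apply] at c2
  have a1 := h.fderiv_hermitian w u v
  have a2 := h.fderiv_hermitian (J w) u (J v)
  rw [JJ, map_neg] at a2
  have a3 := h.fderiv_symm v (J w) u
  have a4 := h.fderiv_symm (J v) w u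
  have a5 := h.fderiv_hermitian u v w
  linarith

theorem IsKaehlerNear.localCurvature_complex (h : IsKaehlerNear G z) (u v w : V) :
    localCurvature G z u v (J w) = J (localCurvature G z u v w) := by
  have hd : ∀ t a b, fderiv ℝ (christoffel G) z t a (J b) =
      J (fderiv ℝ (christoffel G) z t a b) := by
    intro t a b
    have hΓ : ∀ a b : V, HasFDerivAt (fun y => christoffel G y a b)
        (((ContinuousLinearMap.apply ℝ V b).comp (ContinuousLinearMap.apply ℝ _ a)).comp
          (fderiv ℝ (christoffel G) z)) z := fun a b =>
      ((ContinuousLinearMap.apply ℝ V b).comp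
        (ContinuousLinearMap.apply ℝ (V →L[ℝ] V) a)).hasFDerivAt.comp z
          h.differentiableAt_christoffel.hasFDerivAt
    have h2 := (hΓ a (J b)).unique (((ContinuousLinearMap.hasFDerivAt J).comp z
      (hΓ a b)).congr_of_eventuallyEq (h.eventually.mono fun y hy => hy.christoffel_complex a b))
    exact congrArg (fun L => L t) h2
  simp only [localCurvature, hd, h.christoffel_complex, map_add, map_neg]

end LocalKaehler

/-! ### The Ricci form as a trace -/

section RicciForm

variable {V : Type*} [NormedAddCommGroup V] [NormedSpace ℂ V] [FiniteDimensional ℝ V]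
  {G : V → V →L[ℝ] V →L[ℝ] ℝ} {z : V}

local notation "J" => (Complex.I • ContinuousLinearMap.id ℝ V : V →L[ℝ] V)

/-- The curvature operator `w ↦ R(u, v) w`. -/
noncomputable def localCurvatureOperator {E : Type*} [NormedAddCommGroup E] [NormedSpace ℝ E]
    (G : E → E →L[ℝ] E →L[ℝ] ℝ) (z u v : E) : E →ₗ[ℝ] E where
  toFun w := localCurvature G z u v w
  map_add' a b := by
    simp only [localCurvature, map_add]
    abel
  map_smul' c a := by
    simp only [localCurvature, map_smul, RingHom.id_apply]
    module

/-- An endomorphism that is skew-symmetric for a positive definite bilinear form has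
trace zero. -/
theorem trace_eq_zero_of_skew {E : Type*} [NormedAddCommGroup E] [NormedSpace ℝ E]
    [FiniteDimensional ℝ E] (B : E →L[ℝ] E →L[ℝ] ℝ) 
    (hpos : ∀ v, v ≠ 0 → 0 < B v v) (A : E →ₗ[ℝ] E) (hA : ∀ v w, B (A v) w + B v (A w) = 0) :
    LinearMap.trace ℝ E A = 0 := by
  obtain ⟨e, he⟩ := exists_equiv_of_pos B hpos
  have he' : ∀ x y, e x y = B x y := fun x y => by rw [← he]; rfl
  let d : E ≃ₗ[ℝ] Module.Dual ℝ E := e.toLinearEquiv.trans LinearMap.toContinuousLinearMap.symm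
  have hd : ∀ x y, d x y = B x y := he'
  -- Identifying `E` with its dual through `B` turns `A` into minus its transpose, so the trace of
  -- `A` equals its own negative.
  have hconj : d.conj A = -Module.Dual.transpose (R := ℝ) A := by
    ext φ x
    obtain ⟨y, rfl⟩ := d.surjective φ
    have h1 : d.conj A (d y) = d (A y) := by simp [LinearEquiv.conj_apply]
    rw [h1, hd, LinearMap.neg_apply, LinearMap.neg_apply, Module.Dual.transpose_apply,
      LinearMap.comp_apply, hd]
    linarith [hA y x]
  have h2 := LinearMap.trace_conj' A d
  rw [hconj, map_neg, LinearMap.trace_transpose'] at h2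
  linarith

/-- Symmetry of Ricci: by Bianchi the two endomorphisms differ by the skew operator `R(u, v)`, which
has trace zero. -/
theorem IsMetricNear.trace_localCurvatureEndo_symm {E : Type*} [NormedAddCommGroup E]
    [NormedSpace ℝ E] [FiniteDimensional ℝ E] {G : E → E →L[ℝ] E →L[ℝ] ℝ} {z : E}
    (h : IsMetricNear G z) (u v : E) :
    LinearMap.trace ℝ E (localCurvatureEndo G z u v) =
      LinearMap.trace ℝ E (localCurvatureEndo G z v u) := by
  have h1 : localCurvatureEndo G z u v - localCurvatureEndo G z v u =
      localCurvatureOperator G z u v := by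
    ext w
    have := h.localCurvature_bianchi u v w
    change localCurvature G z u w v - localCurvature G z v w u = localCurvature G z u v w
    rw [localCurvature_antisymm u w v, ← sub_eq_zero, ← neg_eq_zero, ← this]
    abel
  have h2 : LinearMap.trace ℝ E (localCurvatureOperator G z u v) = 0 :=
    trace_eq_zero_of_skew (G z) h.pos.self_of_nhds _
      fun a b => h.localCurvature_skew u v a b
  rw [← h1, map_sub] at h2
  linarith

/-- Pair symmetry moves `J` to the other pair of slots, where it commutes with the curvature
operator and is an isometry. -/
theorem IsKaehlerNear.localCurvature_hermitian (h : IsKaehlerNear G z) (u v w : V) :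
    localCurvature G z (J u) (J v) w = localCurvature G z u v w := by
  obtain ⟨e, he⟩ := exists_equiv_of_pos (G z) h.pos.self_of_nhds
  apply e.injective
  have he' : ∀ x, e x = G z x := fun x => by rw [← he]; rfl
  rw [he', he']
  ext x
  rw [h.localCurvature_pair_symm, h.localCurvature_complex, h.hermitian.self_of_nhds,
    ← h.localCurvature_pair_symm]

/-- `tr (R(u, v) ∘ J) = -2 Ric(J u, v)`. -/
theorem IsKaehlerNear.trace_localCurvatureOperator_comp (h : IsKaehlerNear G z) (u v : V) :
    LinearMap.trace ℝ V (localCurvatureOperator G z u v ∘ₗ (J : V →ₗ[ℝ] V)) =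
      -2 * LinearMap.trace ℝ V (localCurvatureEndo G z (J u) v) := by
  have JJ : ∀ x : V, J (J x) = -x := fun x => by simp [smul_smul]
  have hneg : ∀ a b c, localCurvature G z (-a) b c = -localCurvature G z a b c := fun a b c => by
    simp only [localCurvature, map_neg, neg_apply]; abel
  have hJ : ∀ a b : V, LinearMap.trace ℝ V (localCurvatureEndo G z a b ∘ₗ (J : V →ₗ[ℝ] V)) =
      LinearMap.trace ℝ V (localCurvatureEndo G z a (J b)) := by
    intro a b
    rw [LinearMap.trace_comp_comm']
    congr 1
    ext w
    exact (h.localCurvature_complex a w b).symm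
  have hherm : ∀ a b : V, LinearMap.trace ℝ V (localCurvatureEndo G z (J a) (J b)) =
      LinearMap.trace ℝ V (localCurvatureEndo G z a b) := by
    intro a b
    rw [← hJ]
    congr 1
    ext w
    exact h.localCurvature_hermitian a w b
  -- Bianchi for `u`, `v`, `Jw`.
  have hsum : localCurvatureOperator G z u v ∘ₗ (J : V →ₗ[ℝ] V) =
      localCurvatureEndo G z u v ∘ₗ (J : V →ₗ[ℝ] V)
        - localCurvatureEndo G z v u ∘ₗ (J : V →ₗ[ℝ] V) := by
    ext w
    have := h.localCurvature_bianchi u v (J w)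
    change localCurvature G z u v (J w) = localCurvature G z u (J w) v - localCurvature G z v (J w) u
    rw [localCurvature_antisymm u (J w) v, ← sub_eq_zero, ← this]
    abel
  have hlin : ∀ a b : V, LinearMap.trace ℝ V (localCurvatureEndo G z (-a) b) =
      -LinearMap.trace ℝ V (localCurvatureEndo G z a b) := by
    intro a b
    rw [← map_neg]
    congr 1
    ext w
    exact hneg a w b
  -- The trace is `Ric(u, Jv) - Ric(v, Ju)`. Here `Ric(u, Jv) = Ric(Ju, JJv) = -Ric(Ju, v)`;
  -- symmetry brings the sign into the first slot, where `hlin` applies.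
  rw [hsum, map_sub, hJ, hJ, ← hherm u (J v), JJ, h.trace_localCurvatureEndo_symm (J u), hlin,
    h.trace_localCurvatureEndo_symm (J u)]
  ring

end RicciForm

/-! ### Totally real subspaces of half dimension -/

section TotallyReal

variable {V : Type*} [AddCommGroup V] [Module ℝ V]

/-- A relation `Jx = ax` would force `a² = -1`. -/
theorem linearIndependent_complex_pair (J : V →ₗ[ℝ] V) (hJ : ∀ x, J (J x) = -x) {x : V} (hx : x ≠ 0) :
    LinearIndependent ℝ ![x, J x] := by
  rw [LinearIndependent.pair_iff' hx]
  intro a ha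
  have h1 := congrArg J ha
  rw [map_smul, hJ, ← ha, smul_smul] at h1
  have h2 : (a * a + 1) • x = 0 := by rw [add_smul, h1]; simp
  rcases smul_eq_zero.1 h2 with h | h
  · nlinarith [mul_self_nonneg a]
  · exact hx h

variable [FiniteDimensional ℝ V]

/-- If `T` is a subspace of half the dimension that contains no complex line, then an endomorphism
commuting with `J` and preserving `T` satisfies `tr (A ∘ J) = 0`. -/
theorem trace_comp_complex_eq_zero (J A : V →ₗ[ℝ] V) (hJ : ∀ x, J (J x) = -x)
    (hAJ : ∀ x, A (J x) = J (A x)) (T : Submodule ℝ V)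
    (hdim : Module.finrank ℝ V = 2 * Module.finrank ℝ T)
    (hT : ∀ x ∈ T, J x ∈ T → x = 0) (hA : ∀ x ∈ T, A x ∈ T) :
    LinearMap.trace ℝ V (A ∘ₗ J) = 0 := by
  have hinj : Function.Injective J := fun x y hxy => by
    have := congrArg J hxy
    rwa [hJ, hJ, neg_inj] at this
  have hdisj : Disjoint T (T.map J) := by
    rw [Submodule.disjoint_def]
    rintro _ hx ⟨x, hxT, rfl⟩
    rw [hT x hxT hx, map_zero]
  have hcompl : IsCompl T (T.map J) := by
    refine ⟨hdisj, codisjoint_iff.2 (Submodule.eq_top_of_finrank_eq ?_)⟩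
    have h1 := Submodule.finrank_sup_add_finrank_inf_eq T (T.map J)
    rw [hdisj.eq_bot, finrank_bot, (Submodule.equivMapOfInjective J hinj T).finrank_eq.symm] at h1
    omega
  have hint : DirectSum.IsInternal (fun b : Bool => cond b T (T.map J)) := by
    rw [DirectSum.isInternal_submodule_iff_isCompl _ (i := true) (j := false) (by simp)
      (by ext b; cases b <;> simp)]
    exact hcompl
  -- `A ∘ J` is block off-diagonal for `T ⊕ JT`: it maps each summand into the other, and `Bool.not`
  -- has no fixed point.
  refine LinearMap.trace_eq_zero_of_mapsTo_ne hint Bool.not (by simp) ?_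
  rintro (_ | _) x hx
  · obtain ⟨y, hy, rfl⟩ := hx
    change A (J (J y)) ∈ T
    rw [hJ, map_neg]
    exact T.neg_mem (hA y hy)
  · exact ⟨A x, hA x hx, (hAJ x).symm⟩

/-- `T` is its own double orthogonal complement. This converts a vanishing normal component into
tangency. -/
theorem mem_of_forall_orthogonal (B : LinearMap.BilinForm ℝ V) (hsymm : ∀ u v, B u v = B v u)
    (hpos : ∀ v, v ≠ 0 → 0 < B v v) (T : Submodule ℝ V) {x : V}
    (hx : ∀ ν, (∀ t ∈ T, B t ν = 0) → B x ν = 0) : x ∈ T := by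
  have hrefl : B.IsRefl := fun u v h => by rw [hsymm, h]
  have hnd : B.Nondegenerate := by
    refine hrefl.nondegenerate_iff_separatingLeft.2 fun v hv => ?_
    by_contra hne
    exact (hpos v hne).ne' (hv v)
  rw [← LinearMap.BilinForm.orthogonal_orthogonal hnd hrefl T]
  intro ν hν
  change B ν x = 0
  rw [hsymm]
  exact hx ν hν

end TotallyReal

/-! ### Manifolds in charts -/

section ChartDerivatives

variable {E : Type*} [NormedAddCommGroup E] [NormedSpace ℝ E]
  {M : Type*} [TopologicalSpace M] [ChartedSpace E M]

theorem injective_mfderiv_of_mem_maximalAtlas {φ : OpenPartialHomeomorph M E}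
    (hφ : φ ∈ IsManifold.maximalAtlas 𝓘(ℝ, E) ∞ M) {x : M} (hx : x ∈ φ.source) :
    Function.Injective (mfderiv 𝓘(ℝ, E) 𝓘(ℝ, E) φ x) := by
  have h1 : MDifferentiableAt 𝓘(ℝ, E) 𝓘(ℝ, E) φ x :=
    (contMDiffAt_of_mem_maximalAtlas hφ hx).mdifferentiableAt (by simp)
  have h2 : MDifferentiableAt 𝓘(ℝ, E) 𝓘(ℝ, E) φ.symm (φ x) :=
    (contMDiffAt_symm_of_mem_maximalAtlas hφ (φ.map_source hx)).mdifferentiableAt (by simp)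
  have h3 : mfderiv 𝓘(ℝ, E) 𝓘(ℝ, E) (φ.symm ∘ φ) x = ContinuousLinearMap.id ℝ _ := by
    rw [← mfderiv_id]
    refine Filter.EventuallyEq.mfderiv_eq ?_
    filter_upwards [φ.open_source.mem_nhds hx] with y hy using φ.left_inv hy
  rw [mfderiv_comp x h2 h1] at h3
  intro u v huv
  have h4 : ∀ w, mfderiv 𝓘(ℝ, E) 𝓘(ℝ, E) φ.symm (φ x) (mfderiv 𝓘(ℝ, E) 𝓘(ℝ, E) φ x w) = w :=
    fun w => congrArg (fun L => L w) h3
  rw [← h4 u, huv, h4]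

variable [IsManifold 𝓘(ℝ, E) ∞ M]

theorem mdifferentiableAt_chart_symm {φ : OpenPartialHomeomorph M E} (hφ : φ ∈ atlas E M) {z : E}
    (hz : z ∈ φ.target) : MDifferentiableAt 𝓘(ℝ, E) 𝓘(ℝ, E) φ.symm z :=
  ((contMDiffOn_symm_of_mem_maximalAtlas (n := ∞)
    (IsManifold.subset_maximalAtlas hφ)).contMDiffAt
      (φ.open_target.mem_nhds hz)).mdifferentiableAt (by simp)

/-- Tangent vectors are coordinates in the preferred chart, so the differential of `φ.symm` is that
of a transition map. -/
theorem mfderiv_chart_symm_eq {φ : OpenPartialHomeomorph M E} (hφ : φ ∈ atlas E M) {z : E}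
    (hz : z ∈ φ.target) :
    mfderiv 𝓘(ℝ, E) 𝓘(ℝ, E) φ.symm z = fderiv ℝ (chartAt E (φ.symm z) ∘ φ.symm) z := by
  refine (mdifferentiableAt_chart_symm hφ hz).mfderiv.trans ?_
  simp only [writtenInExtChartAt, fderivWithin_univ, mfld_simps]
  rfl

theorem injective_mfderiv_chart_symm {φ : OpenPartialHomeomorph M E} (hφ : φ ∈ atlas E M) {z : E}
    (hz : z ∈ φ.target) : Function.Injective (mfderiv 𝓘(ℝ, E) 𝓘(ℝ, E) φ.symm z) := by
  have h2 := mdifferentiableAt_chart_symm hφ hz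
  have h1 : MDifferentiableAt 𝓘(ℝ, E) 𝓘(ℝ, E) φ (φ.symm z) :=
    (contMDiffAt_of_mem_maximalAtlas (n := ∞) (IsManifold.subset_maximalAtlas hφ)
      (φ.map_target hz)).mdifferentiableAt (by simp)
  have h3 : mfderiv 𝓘(ℝ, E) 𝓘(ℝ, E) (φ ∘ φ.symm) z = ContinuousLinearMap.id ℝ _ := by
    rw [← mfderiv_id]
    refine Filter.EventuallyEq.mfderiv_eq ?_
    filter_upwards [φ.open_target.mem_nhds hz] with y hy using φ.right_inv hy
  rw [mfderiv_comp z h1 h2] at h3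
  intro u v huv
  have h4 : ∀ w, mfderiv 𝓘(ℝ, E) 𝓘(ℝ, E) φ (φ.symm z) (mfderiv 𝓘(ℝ, E) 𝓘(ℝ, E) φ.symm z w) = w :=
    fun w => congrArg (fun L => L w) h3
  rw [← h4 u, huv, h4]

/-- Smoothness of the coordinate vector fields; pairing two of them with the metric gives the smooth
components of `formInChart`. -/
theorem contMDiffAt_mfderiv_chart_symm {φ : OpenPartialHomeomorph M E} (hφ : φ ∈ atlas E M) {z : E}
    (hz : z ∈ φ.target) (u : E) :
    ContMDiffAt 𝓘(ℝ, E) (𝓘(ℝ, E).prod 𝓘(ℝ, E)) ∞ (fun y => (Bundle.TotalSpace.mk' E (φ.symm y)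
      (mfderiv 𝓘(ℝ, E) 𝓘(ℝ, E) φ.symm y u) : TangentBundle 𝓘(ℝ, E) M)) z := by
  have h1 := (contMDiffOn_symm_of_mem_maximalAtlas (I := 𝓘(ℝ, E)) (n := ∞)
    (IsManifold.subset_maximalAtlas hφ)).contMDiffOn_tangentMapWithin (m := ∞) (by simp)
      φ.open_target.uniqueMDiffOn
  have h2 : ContMDiffAt 𝓘(ℝ, E) 𝓘(ℝ, E).tangent ∞
      (fun y => (⟨y, u⟩ : TangentBundle 𝓘(ℝ, E) E)) z :=
    contMDiffAt_vectorSpace_iff_contDiffAt.2 contDiffAt_const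
  have h3 := (h1.contMDiffAt ((φ.open_target.preimage
    (FiberBundle.continuous_proj E (TangentSpace 𝓘(ℝ, E)))).mem_nhds hz)).comp z h2
  refine h3.congr_of_eventuallyEq ?_
  filter_upwards [φ.open_target.mem_nhds hz] with y hy
  simp only [Function.comp_apply, tangentMapWithin, mfderivWithin_of_isOpen φ.open_target hy]

theorem contDiffOn_formInChart [FiniteDimensional ℝ E]
    (g : Bundle.ContMDiffRiemannianMetric 𝓘(ℝ, E) ∞ E (fun y : M => TangentSpace 𝓘(ℝ, E) y))
    {φ : OpenPartialHomeomorph M E} (hφ : φ ∈ atlas E M) :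
    ContDiffOn ℝ ∞ (formInChart g.inner φ) φ.target := by
  rw [contDiffOn_clm_apply]
  intro u
  rw [contDiffOn_clm_apply]
  intro v z hz
  refine ContDiffAt.contDiffWithinAt ?_
  have h1 : ContMDiffAt 𝓘(ℝ, E) (𝓘(ℝ, E).prod 𝓘(ℝ, E →L[ℝ] E →L[ℝ] ℝ)) ∞
      (fun y => Bundle.TotalSpace.mk' (E →L[ℝ] E →L[ℝ] ℝ)
        (E := fun x : M => TangentSpace 𝓘(ℝ, E) x →L[ℝ] TangentSpace 𝓘(ℝ, E) x →L[ℝ] ℝ)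
        (φ.symm y) (g.inner (φ.symm y))) z :=
    g.contMDiff.contMDiffAt.comp z ((contMDiffOn_symm_of_mem_maximalAtlas (n := ∞)
      (IsManifold.subset_maximalAtlas hφ)).contMDiffAt (φ.open_target.mem_nhds hz))
  have h2 := ContMDiffAt.clm_bundle_apply₂ (F₁ := E) (F₂ := E) (F₃ := ℝ)
    (E₃ := Bundle.Trivial M ℝ) h1
    (contMDiffAt_mfderiv_chart_symm hφ hz u) (contMDiffAt_mfderiv_chart_symm hφ hz v)
  simp only [Bundle.contMDiffAt_totalSpace] at h2
  exact h2.2.contDiffAt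

theorem isMetricNear_formInChart [FiniteDimensional ℝ E]
    (g : Bundle.ContMDiffRiemannianMetric 𝓘(ℝ, E) ∞ E (fun y : M => TangentSpace 𝓘(ℝ, E) y))
    {φ : OpenPartialHomeomorph M E} (hφ : φ ∈ atlas E M) {z : E} (hz : z ∈ φ.target) :
    IsMetricNear (formInChart g.inner φ) z where
  contDiffAt := ((contDiffOn_formInChart g hφ).contDiffAt (φ.open_target.mem_nhds hz)).of_le
    (show ((2 : ℕ∞) : WithTop ℕ∞) ≤ ∞ from mod_cast le_top)
  symm := .of_forall fun y u v => g.symm (φ.symm y) _ _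
  pos := by
    filter_upwards [φ.open_target.mem_nhds hz] with y hy v hv
    have hne : mfderiv 𝓘(ℝ, E) 𝓘(ℝ, E) φ.symm y v ≠ 0 := fun h =>
      hv (injective_mfderiv_chart_symm hφ hy (h.trans (map_zero _).symm))
    exact g.pos (φ.symm y) _ hne

end ChartDerivatives

/-! ### Maps in charts -/

section MapsInCharts

variable {E : Type*} [NormedAddCommGroup E] [NormedSpace ℝ E]
  {M : Type*} [TopologicalSpace M] [ChartedSpace E M]
  {V : Type*} [NormedAddCommGroup V] [NormedSpace ℝ V]
  {N : Type*} [TopologicalSpace N] [ChartedSpace V N]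

theorem mfderiv_eq_fderiv_chartAt {F : M → N} {p : M}
    (hF : MDifferentiableAt 𝓘(ℝ, E) 𝓘(ℝ, V) F p) :
    mfderiv 𝓘(ℝ, E) 𝓘(ℝ, V) F p =
      fderiv ℝ (chartAt V (F p) ∘ F ∘ (chartAt E p).symm) (chartAt E p p) := by
  refine hF.mfderiv.trans ?_
  simp only [writtenInExtChartAt, fderivWithin_univ, mfld_simps]
  rfl

theorem contDiffAt_chartAt {F : M → N} (hF : ContMDiff 𝓘(ℝ, E) 𝓘(ℝ, V) ∞ F) (p : M) :
    ContDiffAt ℝ ∞ (chartAt V (F p) ∘ F ∘ (chartAt E p).symm) (chartAt E p p) := by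
  have := (contMDiffAt_iff.1 (hF p)).2
  simpa [contDiffWithinAt_univ, mfld_simps] using this

/-- In the charts of the immersion normal form `F` is an injective linear map; the chain rule
carries injectivity back. -/
theorem Manifold.IsImmersion.injective_mfderiv {F : M → N}
    (hF : Manifold.IsImmersion 𝓘(ℝ, E) 𝓘(ℝ, V) ∞ F) (p : M) :
    Function.Injective (mfderiv 𝓘(ℝ, E) 𝓘(ℝ, V) F p) := by
  have h := hF.isImmersionAt p
  have hFp : MDifferentiableAt 𝓘(ℝ, E) 𝓘(ℝ, V) F p := h.contMDiffAt.mdifferentiableAt (by simp)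
  have hφ := (contMDiffAt_of_mem_maximalAtlas h.domChart_mem_maximalAtlas
    h.mem_domChart_source).mdifferentiableAt (n := ∞) (by simp)
  have hψ := (contMDiffAt_of_mem_maximalAtlas h.codChart_mem_maximalAtlas
    h.mem_codChart_source).mdifferentiableAt (n := ∞) (by simp)
  let L : E →L[ℝ] V := (h.equiv : (E × h.complement) →L[ℝ] V) ∘L ContinuousLinearMap.inl ℝ E _
  have hL : Function.Injective L :=
    h.equiv.injective.comp (LinearMap.inl_injective (R := ℝ) (M := E) (M₂ := h.complement))
  have heq : h.codChart ∘ F =ᶠ[𝓝 p] L ∘ h.domChart := by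
    filter_upwards [h.domChart.open_source.mem_nhds h.mem_domChart_source] with q hq
    have := h.writtenInCharts (show h.domChart q ∈ (h.domChart.extend 𝓘(ℝ, E)).target by
      simpa using h.domChart.map_source hq)
    simpa [L, h.domChart.left_inv hq] using this
  have hLd : MDifferentiableAt 𝓘(ℝ, E) 𝓘(ℝ, V) L (h.domChart p) :=
    L.differentiableAt.mdifferentiableAt
  have h1 := heq.mfderiv_eq (I := 𝓘(ℝ, E)) (I' := 𝓘(ℝ, V))
  rw [mfderiv_comp p hψ hFp, mfderiv_comp p hLd hφ, mfderiv_eq_fderiv, L.fderiv] at h1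
  intro u v huv
  apply injective_mfderiv_of_mem_maximalAtlas h.domChart_mem_maximalAtlas h.mem_domChart_source
  apply hL
  have h2 : ∀ w, mfderiv 𝓘(ℝ, V) 𝓘(ℝ, V) h.codChart (F p) (mfderiv 𝓘(ℝ, E) 𝓘(ℝ, V) F p w) =
      L (mfderiv 𝓘(ℝ, E) 𝓘(ℝ, E) h.domChart p w) := fun w => congrArg (fun A => A w) h1
  exact (h2 u).symm.trans ((congrArg _ huv).trans (h2 v))

variable [IsManifold 𝓘(ℝ, V) ∞ N]

/-- The normal component of `F^* R` vanishes for a totally geodesic immersion `F`. -/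
theorem IsTotallyGeodesic.normalCurvatureVanishes [FiniteDimensional ℝ E] [FiniteDimensional ℝ V]
    (g : Bundle.ContMDiffRiemannianMetric 𝓘(ℝ, V) ∞ V (fun y : N => TangentSpace 𝓘(ℝ, V) y))
    {F : M → N} (hF : Manifold.IsImmersion 𝓘(ℝ, E) 𝓘(ℝ, V) ∞ F)
    (h : IsTotallyGeodesic (E := E) (V := V) g.inner F) :
    NormalCurvatureVanishes (V := V) E g.inner F := by
  intro p X Y Z ν hν
  have hd := mfderiv_eq_fderiv_chartAt ((hF.contMDiff p).mdifferentiableAt (by simp))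
  have hinj := hF.injective_mfderiv p
  have hleft := (chartAt E p).left_inv (mem_chart_source E p)
  have hfz : (chartAt V (F p) ∘ F ∘ (chartAt E p).symm) (chartAt E p p) = chartAt V (F p) (F p) := by
    simp [hleft]
  have hG := isMetricNear_formInChart g (chart_mem_atlas V (F p)) (mem_chart_target V (F p))
  rw [← hfz] at hG
  have hnear : ∀ᶠ y in 𝓝 (chartAt E p p), F ((chartAt E p).symm y) ∈ (chartAt V (F p)).source := by
    have hc : ContinuousAt (F ∘ (chartAt E p).symm) (chartAt E p p) :=
      hF.contMDiff.continuous.continuousAt.comp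
        ((chartAt E p).continuousAt_symm (mem_chart_target E p))
    refine hc.eventually_mem ((chartAt V (F p)).open_source.mem_nhds ?_)
    simp [hleft]
  rw [hd] at hinj
  obtain ⟨x, hx⟩ := localCurvature_mem_range hG
    ((contDiffAt_chartAt hF.contMDiff p).of_le
      (show ((3 : ℕ∞) : WithTop ℕ∞) ≤ ∞ from mod_cast le_top)) hinj
    (fun y v w => christoffel (formInChart (pullbackForm (E := E) g.inner F) (chartAt E p)) y v w)
    (by
      filter_upwards [(chartAt E p).open_target.mem_nhds (mem_chart_target E p), hnear]
        with y hy hy' v w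
      exact sub_eq_zero.1 (h _ (chart_mem_atlas E p) _ (chart_mem_atlas V (F p)) y hy hy' v w))
    X Y Z
  -- `curvature` is computed in the preferred chart at `F p`, the chart used here, so no
  -- transformation law is needed.
  have hcurv : curvature g.inner (F p) (mfderiv 𝓘(ℝ, E) 𝓘(ℝ, V) F p X)
      (mfderiv 𝓘(ℝ, E) 𝓘(ℝ, V) F p Y) (mfderiv 𝓘(ℝ, E) 𝓘(ℝ, V) F p Z) =
      mfderiv 𝓘(ℝ, E) 𝓘(ℝ, V) F p x := by
    rw [← hd, hfz] at hx
    exact hx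
  rw [hcurv]
  exact hν x

end MapsInCharts

/-! ### Kähler manifolds in charts -/

section KaehlerCharts

variable {V : Type*} [NormedAddCommGroup V] [NormedSpace ℂ V]
  {N : Type*} [TopologicalSpace N] [ChartedSpace V N] [IsManifold 𝓘(ℂ, V) ω N]

/-- Transition maps are holomorphic, so their real differentials are complex linear. -/
theorem mfderiv_chart_symm_complex {ψ : OpenPartialHomeomorph N V} (hψ : ψ ∈ atlas V N) {z : V}
    (hz : z ∈ ψ.target) (u : V) :
    mfderiv 𝓘(ℝ, V) 𝓘(ℝ, V) ψ.symm z (Complex.I • u : V) =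
      complexStructure (ψ.symm z) (mfderiv 𝓘(ℝ, V) 𝓘(ℝ, V) ψ.symm z u) := by
  have h := (contDiffGroupoid ω 𝓘(ℂ, V)).compatible hψ (chart_mem_atlas V (ψ.symm z))
  rw [contDiffGroupoid, mem_groupoid_of_pregroupoid] at h
  have h2 : ContDiffOn ℂ ω (𝓘(ℂ, V) ∘ (ψ.symm ≫ₕ chartAt V (ψ.symm z)) ∘ 𝓘(ℂ, V).symm)
      (𝓘(ℂ, V).symm ⁻¹' (ψ.symm ≫ₕ chartAt V (ψ.symm z)).source ∩ Set.range 𝓘(ℂ, V)) := h.1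
  have h3 : ContDiffOn ℂ ω (chartAt V (ψ.symm z) ∘ ψ.symm)
      (ψ.symm ≫ₕ chartAt V (ψ.symm z)).source := by simpa using h2
  have hmem : z ∈ (ψ.symm ≫ₕ chartAt V (ψ.symm z)).source := by simp [hz]
  have h4 : DifferentiableAt ℂ (chartAt V (ψ.symm z) ∘ ψ.symm) z :=
    (h3.contDiffAt ((OpenPartialHomeomorph.open_source _).mem_nhds hmem)).differentiableAt (by simp)
  rw [mfderiv_chart_symm_eq hψ hz, h4.fderiv_restrictScalars ℝ]
  exact map_smul (fderiv ℂ (chartAt V (ψ.symm z) ∘ ψ.symm) z) Complex.I u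

theorem formInChart_kaehlerForm
    (g : ∀ y : N, TangentSpace 𝓘(ℝ, V) y →L[ℝ] TangentSpace 𝓘(ℝ, V) y →L[ℝ] ℝ)
    {ψ : OpenPartialHomeomorph N V} (hψ : ψ ∈ atlas V N) {z : V} (hz : z ∈ ψ.target) :
    formInChart (kaehlerForm g) ψ z =
      formInChart g ψ z ∘L (Complex.I • ContinuousLinearMap.id ℝ V : V →L[ℝ] V) := by
  ext u v
  change g (ψ.symm z) (complexStructure (ψ.symm z) (mfderiv 𝓘(ℝ, V) 𝓘(ℝ, V) ψ.symm z u))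
      (mfderiv 𝓘(ℝ, V) 𝓘(ℝ, V) ψ.symm z v) =
    g (ψ.symm z) (mfderiv 𝓘(ℝ, V) 𝓘(ℝ, V) ψ.symm z (Complex.I • u : V))
      (mfderiv 𝓘(ℝ, V) 𝓘(ℝ, V) ψ.symm z v)
  rw [mfderiv_chart_symm_complex hψ hz]

theorem isKaehlerNear_formInChart [FiniteDimensional ℝ V]
    (g : Bundle.ContMDiffRiemannianMetric 𝓘(ℝ, V) ∞ V (fun y : N => TangentSpace 𝓘(ℝ, V) y))
    (hg : IsKaehler (V := V) g.inner) {ψ : OpenPartialHomeomorph N V} (hψ : ψ ∈ atlas V N) {z : V}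
    (hz : z ∈ ψ.target) : IsKaehlerNear (formInChart g.inner ψ) z where
  toIsMetricNear := isMetricNear_formInChart g hψ hz
  hermitian := by
    filter_upwards [ψ.open_target.mem_nhds hz] with y hy u v
    change g.inner (ψ.symm y) (mfderiv 𝓘(ℝ, V) 𝓘(ℝ, V) ψ.symm y (Complex.I • u : V))
      (mfderiv 𝓘(ℝ, V) 𝓘(ℝ, V) ψ.symm y (Complex.I • v : V)) = _
    rw [mfderiv_chart_symm_complex hψ hy, mfderiv_chart_symm_complex hψ hy]
    exact hg.hermitian _ _ _
  closed := by
    filter_upwards [ψ.open_target.mem_nhds hz] with y hy u v w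
    have hG := (isMetricNear_formInChart g hψ hy).differentiableAt.hasFDerivAt
    -- Since `J` is constant in the chart, only the derivative of the metric survives.
    have h1 : ∀ a b c : V, fderiv ℝ (formInChart (kaehlerForm g.inner) ψ) y a b c =
        fderiv ℝ (formInChart g.inner ψ) y a
          ((Complex.I • ContinuousLinearMap.id ℝ V : V →L[ℝ] V) b) c := by
      intro a b c
      have h2 := (hG.clm_comp (hasFDerivAt_const
        (Complex.I • ContinuousLinearMap.id ℝ V : V →L[ℝ] V) y)).congr_of_eventuallyEq
          (f₁ := formInChart (kaehlerForm g.inner) ψ) (by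
            filter_upwards [ψ.open_target.mem_nhds hy] with x hx
              using formInChart_kaehlerForm g.inner hψ hx)
      rw [h2.fderiv, add_apply, ContinuousLinearMap.comp_apply, ContinuousLinearMap.comp_apply,
        zero_apply, map_zero, zero_add]
      rfl
    rw [← h1, ← h1, ← h1]
    exact hg.closed ψ hψ y hy u v w

end KaehlerCharts

/-! ### Immersions without complex directions and the Ricci form -/

section NoComplexDirections

variable {V : Type*} [NormedAddCommGroup V] [NormedSpace ℂ V]
  {N : Type*} [TopologicalSpace N] [ChartedSpace V N]
  {E : Type*} [NormedAddCommGroup E] [NormedSpace ℝ E]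
  {M : Type*} [TopologicalSpace M] [ChartedSpace E M]

/-- Otherwise `dF a` and `J dF a = dF b` are independent, and `a`, `b` span a complex direction. -/
theorem HasNoComplexDirections.eq_zero {F : M → N} (h : HasNoComplexDirections (V := V) E F) (p : M)
    {a b : TangentSpace 𝓘(ℝ, E) p}
    (hab : mfderiv 𝓘(ℝ, E) 𝓘(ℝ, V) F p b =
      complexStructure (F p) (mfderiv 𝓘(ℝ, E) 𝓘(ℝ, V) F p a)) :
    mfderiv 𝓘(ℝ, E) 𝓘(ℝ, V) F p a = 0 := by
  by_contra hne
  have hJ : ∀ x : TangentSpace 𝓘(ℝ, V) (F p),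
      complexStructure (F p) (complexStructure (F p) x) = -x := fun x => by
    have JJ : ∀ w : V, Complex.I • Complex.I • w = -w := fun w => by simp [smul_smul]
    exact JJ x
  have hli := linearIndependent_complex_pair
    (complexStructure (F p)).toLinearMap hJ hne
  have hli' : LinearIndependent ℝ ![a, b] := by
    refine LinearIndependent.of_comp (mfderiv 𝓘(ℝ, E) 𝓘(ℝ, V) F p).toLinearMap ?_
    convert hli using 1
    ext i
    fin_cases i
    · rfl
    · exact hab
  refine h p (Submodule.span ℝ (Set.range ![a, b])) (by rw [finrank_span_eq_card hli']; simp) ?_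
  intro X hX
  rw [Matrix.range_cons, Matrix.range_cons, Matrix.range_empty, Set.union_empty,
    Set.singleton_union, Submodule.mem_span_pair] at hX
  obtain ⟨s, t, rfl⟩ := hX
  -- With `dF b = J dF a`, one has `J(s dF a + t dF b) = s dF b - t dF a`.
  refine ⟨s • b - t • a, ?_, ?_⟩
  · refine Submodule.sub_mem _ (Submodule.smul_mem _ _ (Submodule.subset_span ⟨1, rfl⟩))
      (Submodule.smul_mem _ _ (Submodule.subset_span ⟨0, rfl⟩))
  · rw [map_add, map_smul, map_smul, map_add, map_smul, map_smul, map_sub, map_smul, map_smul, hab,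
      hJ, smul_neg, sub_eq_add_neg]

variable [FiniteDimensional ℂ V] [IsManifold 𝓘(ℂ, V) ω N]

/-- If the normal component of `F^* R` vanishes and `F` is an immersion of half dimension without
complex directions, the pullback of the Ricci form vanishes. -/
theorem HasNoComplexDirections.ricciForm_eq_zero [IsManifold 𝓘(ℝ, E) ∞ M] [FiniteDimensional ℝ E]
    (hdim : Module.finrank ℝ E = Module.finrank ℂ V)
    (g : Bundle.ContMDiffRiemannianMetric 𝓘(ℝ, V) ∞ V (fun y : N => TangentSpace 𝓘(ℝ, V) y))
    (hg : IsKaehler (V := V) g.inner) {F : M → N}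
    (hF : Manifold.IsImmersion 𝓘(ℝ, E) 𝓘(ℝ, V) ∞ F) (h : HasNoComplexDirections (V := V) E F)
    (hR : NormalCurvatureVanishes (V := V) E g.inner F) (p : M) (X Y : TangentSpace 𝓘(ℝ, E) p) :
    ricciForm (V := V) g.inner (F p) (mfderiv 𝓘(ℝ, E) 𝓘(ℝ, V) F p X)
      (mfderiv 𝓘(ℝ, E) 𝓘(ℝ, V) F p Y) = 0 := by
  let D : E →L[ℝ] V := mfderiv 𝓘(ℝ, E) 𝓘(ℝ, V) F p
  have hinj : Function.Injective D := hF.injective_mfderiv p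
  let B : V →L[ℝ] V →L[ℝ] ℝ := g.inner (F p)
  have hK := isKaehlerNear_formInChart g hg (chart_mem_atlas V (F p)) (mem_chart_target V (F p))
  set G := formInChart g.inner (chartAt V (F p))
  set z := chartAt V (F p) (F p)
  have htr : LinearMap.trace ℝ V (localCurvatureOperator G z (D X) (D Y) ∘ₗ
      ((Complex.I • ContinuousLinearMap.id ℝ V : V →L[ℝ] V) : V →ₗ[ℝ] V)) = 0 := by
    refine trace_comp_complex_eq_zero _ _ (fun x => by simp [smul_smul])
      (fun x => hK.localCurvature_complex (D X) (D Y) x) D.toLinearMap.range ?_ ?_ ?_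
    · rw [LinearMap.finrank_range_of_inj hinj, hdim, finrank_real_of_complex]
    · rintro _ ⟨a, rfl⟩ ⟨b, hb⟩
      exact h.eq_zero p hb
    · rintro _ ⟨a, rfl⟩
      -- `hR` only tests against normal vectors; double orthogonality gives membership in the
      -- tangent space.
      refine mem_of_forall_orthogonal (ContinuousLinearMap.toLinearMap₁₂ B) (g.symm (F p))
        (g.pos (F p)) _ fun ν hν => ?_
      exact hR p X Y a ν fun W => hν _ ⟨W, rfl⟩
  rw [hK.trace_localCurvatureOperator_comp] at htr
  exact (mul_eq_zero.1 htr).resolve_left (by norm_num)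

end NoComplexDirections

theorem proposition1p1 (n : ℕ)
    {V : Type*} [NormedAddCommGroup V] [NormedSpace ℂ V] [FiniteDimensional ℂ V]
    (hV : Module.finrank ℂ V = 2 * n)
    {N : Type*} [TopologicalSpace N] [ChartedSpace V N] [IsManifold 𝓘(ℂ, V) ω N]
    (g : Bundle.ContMDiffRiemannianMetric 𝓘(ℝ, V) ∞ V
      (fun y : N => TangentSpace 𝓘(ℝ, V) y))
    (hg : IsKaehler (V := V) g.inner)
    {E : Type*} [NormedAddCommGroup E] [NormedSpace ℝ E] [FiniteDimensional ℝ E]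
    (hE : Module.finrank ℝ E = 2 * n)
    {M : Type*} [TopologicalSpace M] [ChartedSpace E M] [IsManifold 𝓘(ℝ, E) ∞ M]
    (F : M → N) (hF : Manifold.IsImmersion 𝓘(ℝ, E) 𝓘(ℝ, V) ∞ F) :
    (IsTotallyGeodesic (E := E) (V := V) g.inner F → NormalCurvatureVanishes (V := V) E g.inner F) ∧
    (HasNoComplexDirections (V := V) E F → NormalCurvatureVanishes (V := V) E g.inner F →
      (∀ (p : M) (X Y : TangentSpace 𝓘(ℝ, E) p),
        ricciForm (V := V) g.inner (F p) (mfderiv 𝓘(ℝ, E) 𝓘(ℝ, V) F p X)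
          (mfderiv 𝓘(ℝ, E) 𝓘(ℝ, V) F p Y) = 0) ∧
      (IsEinstein (E := V) g.inner →
        (∃ (y : N) (u v : TangentSpace 𝓘(ℝ, V) y), ricci (E := V) g.inner y u v ≠ 0) →
        IsLagrangian (V := V) E g.inner F)) := by
  refine ⟨IsTotallyGeodesic.normalCurvatureVanishes g hF, fun hC hR => ?_⟩
  have hΨ := hC.ricciForm_eq_zero (hE.trans hV.symm) g hg hF hR
  refine ⟨hΨ, fun ⟨c, hc⟩ ⟨y, u, v, hne⟩ p X Y => ?_⟩
  have h0 := hΨ p X Y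
  rw [ricciForm, hc] at h0
  -- `h0` says `c * ω(dF X, dF Y) = 0`, and `c = 0` would make Ricci vanish identically.
  refine (mul_eq_zero.1 h0).resolve_left fun hc0 => hne ?_
  rw [hc, hc0, zero_mul]
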